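/- Let $\mu$ and $\nu$ be probability measures on the unit circle $\partial\mathbb{D}=\{z\in\mathbb{C}:|z|=1\}$ that are nontrivial, i.e. have infinite support. For such a measure, say $\mu$, let $\Phi_n(\mu)$, $n\ge 0$, be its monic orthogonal polynomials ($\Phi_n(\mu)$ is monic of degree $n$ and $\int \overline{\Phi_m(\mu)}\,\Phi_n(\mu)\,d\mu=0$ for $m\neq n$), let $\Phi_n^*(\mu)$ be the reversed polynomials, $\Phi_n^*(\mu;z)=z^n\,\overline{\Phi_n(\mu;1/\bar z)}$ (if $\Phi_n(\mu;z)=\sum_{k=0}^n\kappa_{k}z^k$, then $\Phi_n^*(\mu;z)=\sum_{k=0}^n\bar\kappa_{n-k}z^k$), and let $\alpha_n(\mu)$, $n\ge 0$, be its Verblunsky coefficients, defined by $\Phi_{n+1}(\mu;z)=z\Phi_n(\mu;z)-\bar\alpha_n(\mu)\Phi_n^*(\mu;z)$, equivalently $\alpha_n(\mu)=-\overline{\Phi_{n+1}(\mu;0)}$. Then $$\frac{\Phi^*_{n+1}(\mu)}{\Phi^*_n(\mu)}-\frac{\Phi^*_{n+1}(\nu)}{\Phi^*_n(\nu)}\longrightarrow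 0\qquad(n\to\infty)$$ uniformly on compact subsets of the open unit disk $\mathbb{D}=\{z\in\mathbb{C}:|z|<1\}$ if and only if for every integer $\ell\ge 1$ $$\lim_{n\to\infty}\bigl[\alpha_n(\mu)\,\bar\alpha_{n-\ell}(\mu)-\alpha_n(\nu)\,\bar\alpha_{n-\ell}(\nu)\bigr]=0 .$$ -/

import Mathlib

namespace OPUC

open Polynomial MeasureTheory ComplexConjugate

/-- A probability measure on the unit circle is nontrivial if its (topological) support is
an infinite set. -/
def Nontrivial (μ : Measure (Metric.sphere (0 : ℂ) 1)) : Prop :=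
  μ.support.Infinite

/-- The inner product `⟨p, q⟩ = ∫ conj (p z) * q z dμ(z)` of two complex polynomials
in `L²(μ)`. -/
noncomputable def polyInner (μ : Measure (Metric.sphere (0 : ℂ) 1)) (p q : ℂ[X]) : ℂ :=
  ∫ z : Metric.sphere (0 : ℂ) 1, conj (p.eval (z : ℂ)) * q.eval (z : ℂ) ∂μ

/-- The monic orthogonal polynomials `Φ_n` of `μ`, obtained from `1, z, z ^ 2, …` by the
(unnormalized) Gram-Schmidt process in `L²(μ)`:
`Φ_n = z ^ n - ∑_{k < n} (⟨Φ_k, z ^ n⟩ / ⟨Φ_k, Φ_k⟩) Φ_k`. -/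
noncomputable def monicOP (μ : Measure (Metric.sphere (0 : ℂ) 1)) (n : ℕ) : ℂ[X] :=
  X ^ n - ∑ k : Fin n,
    C (polyInner μ (monicOP μ k) (X ^ n) / polyInner μ (monicOP μ k) (monicOP μ k)) *
      monicOP μ k
termination_by n
decreasing_by all_goals exact k.isLt

/-- The reversed polynomials `Φ_n^*`: the coefficient of `z ^ k` in `Φ_n^*` is the complex
conjugate of the coefficient of `z ^ (n - k)` in `Φ_n`, for `0 ≤ k ≤ n`. -/
noncomputable def reversedOP (μ : Measure (Metric.sphere (0 : ℂ) 1)) (n : ℕ) : ℂ[X] :=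
  ((monicOP μ n).map (starRingEnd ℂ)).reflect n

/-- The Verblunsky coefficients `α_n = -conj (Φ_{n+1}(0))`, `n ≥ 0`. Since `Φ_n^*(0) = 1`, this
is the number for which `Φ_{n+1}(z) = z Φ_n(z) - conj (α_n) Φ_n^*(z)`. -/
noncomputable def verblunsky (μ : Measure (Metric.sphere (0 : ℂ) 1)) (n : ℕ) : ℂ :=
  -conj ((monicOP μ (n + 1)).eval 0)

end OPUC

/-! ### Local uniform smallness on the disk, and Schur chains. -/

namespace OPUC

open Filter Topology Metric ComplexConjugate

/-! With b_n = Φ_n/Φ_n^*, the Szegő recursion gives Φ*_{n+1}/Φ*_n = 1 - z α_n b_n, and the b_n are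
Schur functions obeying a Schur recursion (`isSchurChain`). The factor z is harmless by the maximum
principle, so the claim concerns only α_n b_n for μ minus the same for ν.

Let D_{n,k} be the difference of α_{n+k} b_n for the two measures, and γ_{n,k} that of α_{n+k+1}
conj(α_n). `sub_recursion` expresses z D_{n,k+1} through D_{n+1,k}, D_{n,0} and γ_{n,k}. If D_{n,0}
→ 0, the value at z = 0 and induction on k give D_{n,k} → 0 and γ_{n,k} → 0. If all γ_{n,k} → 0, the
same identity contracts the D_{n,k} on a small disk (`eventually_norm_smul_sub_le`), and the Vitali
argument `LocallySmall.of_small_near_zero` extends this to the whole disk. -/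

/-- The functions `F n` tend to `0` uniformly on every closed disk of radius less than `1`
centred at the origin. -/
def LocallySmall (F : ℕ → ℂ → ℂ) : Prop :=
  ∀ r < 1, ∀ ε > 0, ∀ᶠ n in atTop, ∀ z, ‖z‖ ≤ r → ‖F n z‖ ≤ ε

theorem tendstoUniformlyOn_compacts_iff_locallySmall (F : ℕ → ℂ → ℂ) :
    (∀ K : Set ℂ, IsCompact K → K ⊆ ball (0 : ℂ) 1 →
      TendstoUniformlyOn F (fun _ => (0 : ℂ)) atTop K) ↔ LocallySmall F := by
  constructor
  · intro h r hr ε hε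
    have := h (closedBall 0 r) (isCompact_closedBall _ _) (closedBall_subset_ball hr)
    rw [Metric.tendstoUniformlyOn_iff] at this
    filter_upwards [this ε hε] with n hn z hz
    have := hn z (by simpa using hz)
    rw [dist_zero_left] at this
    exact this.le
  · intro h K hK hKb
    obtain ⟨r, hr, hKr⟩ := exists_lt_subset_ball hK.isClosed hKb
    rw [Metric.tendstoUniformlyOn_iff]
    intro ε hε
    filter_upwards [h r hr (ε / 2) (half_pos hε)] with n hn z hz
    rw [dist_zero_left]
    have := hn z (by simpa using (mem_ball.1 (hKr hz)).le)
    linarith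

/-- Maximum modulus: on a circle of radius s > 0 dividing by z costs only the factor 1/s, and the
bound there passes to the interior. -/
theorem LocallySmall.of_id_mul {F : ℕ → ℂ → ℂ} (hd : ∀ n, DifferentiableOn ℂ (F n) (ball 0 1))
    (h : LocallySmall fun n z => z * F n z) : LocallySmall F := by
  intro r hr ε hε
  obtain ⟨s, hs, hs1⟩ := exists_between (max_lt hr one_pos)
  obtain ⟨hrs, hs0⟩ := max_lt_iff.1 hs
  filter_upwards [h s hs1 (s * ε) (mul_pos hs0 hε)] with n hn z hz
  refine Complex.norm_le_of_forall_mem_frontier_norm_le (U := ball 0 s) isBounded_ball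
    ((hd n).diffContOnCl_ball (closedBall_subset_ball hs1)) (fun w hw => ?_)
    (subset_closure (by simpa using hz.trans_lt hrs))
  rw [frontier_ball _ hs0.ne', mem_sphere_zero_iff_norm] at hw
  have := hn w hw.le
  rw [norm_mul, hw] at this
  exact le_of_mul_le_mul_left this hs0

theorem locallySmall_id_mul_iff {F : ℕ → ℂ → ℂ}
    (hd : ∀ n, DifferentiableOn ℂ (F n) (ball 0 1)) :
    (LocallySmall fun n z => z * F n z) ↔ LocallySmall F := by
  refine ⟨LocallySmall.of_id_mul hd, fun h r hr ε hε => ?_⟩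
  filter_upwards [h r hr ε hε] with n hn z hz
  rw [norm_mul]
  exact (mul_le_of_le_one_left (norm_nonneg _) (hz.trans hr.le)).trans (hn z hz)

/-- A form of Vitali's theorem: a uniformly bounded sequence of holomorphic functions on the unit
disk which tends to `0` uniformly near the origin tends to `0` locally uniformly. -/
theorem LocallySmall.of_small_near_zero {F : ℕ → ℂ → ℂ} {M ρ : ℝ} (hρ : 0 < ρ) (hρ1 : ρ < 1)
    (hd : ∀ n, DifferentiableOn ℂ (F n) (ball 0 1))
    (hM : ∀ n, ∀ z ∈ ball (0 : ℂ) 1, ‖F n z‖ ≤ M)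
    (h : ∀ ε > 0, ∀ᶠ n in atTop, ∀ z, ‖z‖ ≤ ρ → ‖F n z‖ ≤ ε) : LocallySmall F := by
  have cauchy : ∀ (n j : ℕ) (s C : ℝ), 0 < s → s < 1 → (∀ z, ‖z‖ = s → ‖F n z‖ ≤ C) →
      ‖iteratedDeriv j (F n) 0‖ / (j.factorial : ℝ) ≤ C / s ^ j := by
    intro n j s C hs hs1 hC
    have := Complex.norm_iteratedDeriv_le_of_forall_mem_sphere_norm_le (c := 0) j hs
      ((hd n).diffContOnCl_ball (closedBall_subset_ball hs1)) (fun z hz => hC z (by simpa using hz))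
    rw [div_le_iff₀ (by positivity)]
    calc _ ≤ _ := this
      _ = _ := by ring
  have coeff_tendsto : ∀ j : ℕ, Tendsto
      (fun n => ‖iteratedDeriv j (F n) 0‖ / (j.factorial : ℝ)) atTop (𝓝 0) := by
    intro j
    rw [Metric.tendsto_nhds]
    intro ε hε
    filter_upwards [h (ε / 2 * ρ ^ j) (by positivity)] with n hn
    have := cauchy n j ρ _ hρ hρ1 (fun z hz => hn z hz.le)
    rw [mul_div_cancel_right₀ _ (by positivity)] at this
    rw [dist_zero_right, Real.norm_of_nonneg (by positivity)]
    linarith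
  intro r hr ε hε
  -- Radii max r 0 < r' < s < 1: Cauchy bounds on the circle of radius s make the Taylor series at
  -- r' geometrically dominated, so coefficientwise convergence suffices.
  obtain ⟨r', hr', hr'1⟩ := exists_between (max_lt hr one_pos)
  obtain ⟨hrr', hr'0⟩ := max_lt_iff.1 hr'
  obtain ⟨s, hs, hs1⟩ := exists_between hr'1
  have hs0 : 0 < s := hr'0.trans hs
  have hsum : Summable fun j : ℕ => M * (r' / s) ^ j :=
    (summable_geometric_of_lt_one (by positivity) ((div_lt_one hs0).2 hs)).mul_left M
  have hbound : ∀ n j, ‖iteratedDeriv j (F n) 0‖ / (j.factorial : ℝ) * r' ^ j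
      ≤ M * (r' / s) ^ j := by
    intro n j
    have := cauchy n j s M hs0 hs1 (fun z hz => hM n z (by simpa [hz] using hs1))
    calc _ ≤ M / s ^ j * r' ^ j := by gcongr
      _ = _ := by rw [div_pow]; ring
  have hlim := tendsto_tsum_of_dominated_convergence (𝓕 := atTop)
    (f := fun n j => ‖iteratedDeriv j (F n) 0‖ / (j.factorial : ℝ) * r' ^ j) (g := fun _ => 0)
    hsum (fun j => by simpa using (coeff_tendsto j).mul_const (r' ^ j))
    (Eventually.of_forall fun n j => by
      rw [Real.norm_of_nonneg (by positivity)]; exact hbound n j)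
  rw [tsum_zero] at hlim
  filter_upwards [hlim.eventually (ge_mem_nhds hε)] with n hn z hz
  have hz1 : z ∈ ball (0 : ℂ) 1 := by simpa using hz.trans_lt hr
  have htaylor := Complex.hasSum_taylorSeries_on_ball (hd n) hz1
  refine le_trans (htaylor.norm_le_of_bounded (Summable.hasSum (Summable.of_nonneg_of_le
    (fun j => by positivity) (hbound n) hsum)) (fun j => ?_)) hn
  rw [norm_smul, norm_smul, norm_pow, sub_zero, norm_inv, Complex.norm_natCast]
  calc _ = ‖iteratedDeriv j (F n) 0‖ / (j.factorial : ℝ) * ‖z‖ ^ j := by ring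
    _ ≤ _ := by gcongr; exact hz.trans hrr'.le

/-- `b n` is a sequence of Schur functions on the unit disk generated from `b 0` by the Schur
recursion with parameters `a n`. -/
structure IsSchurChain (a : ℕ → ℂ) (b : ℕ → ℂ → ℂ) : Prop where
  norm_param_le : ∀ n, ‖a n‖ ≤ 1
  differentiableOn : ∀ n, DifferentiableOn ℂ (b n) (ball 0 1)
  norm_le : ∀ n, ∀ z ∈ ball (0 : ℂ) 1, ‖b n z‖ ≤ 1
  recursion : ∀ n, ∀ z ∈ ball (0 : ℂ) 1, b (n + 1) z * (1 - a n * z * b n z) = z * b n z - conj (a n)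

namespace IsSchurChain

variable {a a' : ℕ → ℂ} {b b' : ℕ → ℂ → ℂ}

theorem norm_smul_le (h : IsSchurChain a b) (k n : ℕ) {z : ℂ} (hz : z ∈ ball (0 : ℂ) 1) :
    ‖a k * b n z‖ ≤ 1 := by
  rw [norm_mul]
  exact mul_le_one₀ (h.norm_param_le k) (norm_nonneg _) (h.norm_le n z hz)

/-- The multiplier has one absolute index, so offset k at n + 1 matches offset k + 1 at n; this is
why all offsets must be treated together. -/
theorem smul_recursion (h : IsSchurChain a b) (k n : ℕ) {z : ℂ} (hz : z ∈ ball (0 : ℂ) 1) :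
    a (n + 1 + k) * b (n + 1) z * (1 - z * (a n * b n z)) =
      z * (a (n + (k + 1)) * b n z) - a (n + (k + 1)) * conj (a n) := by
  rw [show n + 1 + k = n + (k + 1) by ring]
  linear_combination a (n + (k + 1)) * h.recursion n z hz

theorem differentiableOn_sub (h : IsSchurChain a b) (h' : IsSchurChain a' b') (k n : ℕ) :
    DifferentiableOn ℂ (fun z => a (n + k) * b n z - a' (n + k) * b' n z) (ball 0 1) :=
  ((h.differentiableOn n).const_mul _).sub ((h'.differentiableOn n).const_mul _)

/-- The difference of the recursions of two Schur chains. -/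
theorem sub_recursion (h : IsSchurChain a b) (h' : IsSchurChain a' b') (k n : ℕ) {z : ℂ}
    (hz : z ∈ ball (0 : ℂ) 1) :
    z * (a (n + (k + 1)) * b n z - a' (n + (k + 1)) * b' n z) =
      (a (n + 1 + k) * b (n + 1) z - a' (n + 1 + k) * b' (n + 1) z) * (1 - z * (a n * b n z)) -
      z * (a' (n + 1 + k) * b' (n + 1) z) * (a n * b n z - a' n * b' n z) +
      (a (n + (k + 1)) * conj (a n) - a' (n + (k + 1)) * conj (a' n)) := by
  linear_combination - h.smul_recursion k n hz + h'.smul_recursion k n hz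

theorem locallySmall_smul_sub_of_locallySmall (h : IsSchurChain a b) (h' : IsSchurChain a' b')
    (hs : LocallySmall fun n z => a n * b n z - a' n * b' n z) (k : ℕ) :
    LocallySmall fun n z => a (n + k) * b n z - a' (n + k) * b' n z := by
  induction k with
  | zero => simpa using hs
  | succ k ih =>
    refine LocallySmall.of_id_mul (h.differentiableOn_sub h' (k + 1)) ?_
    intro r hr ε hε
    have h0 : (0 : ℂ) ∈ ball (0 : ℂ) 1 := by simp
    filter_upwards [hs r hr (ε / 4) (by positivity),
      (tendsto_add_atTop_nat 1).eventually (ih r hr (ε / 4) (by positivity)),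
      (tendsto_add_atTop_nat 1).eventually (ih 0 one_pos (ε / 4) (by positivity))]
      with n hn0 hn hnz z hz
    have hz1 : z ∈ ball (0 : ℂ) 1 := by simpa using hz.trans_lt hr
    have hzn : ‖z‖ ≤ 1 := hz.trans hr.le
    -- At z = 0 the recursion identifies this quantity with minus the offset-k difference at n + 1.
    have hγ : ‖a (n + (k + 1)) * conj (a n) - a' (n + (k + 1)) * conj (a' n)‖ ≤ ε / 4 := by
      have e := h.sub_recursion h' k n h0
      simp only [zero_mul, sub_zero, mul_one] at e
      rw [← norm_neg, ← eq_neg_of_add_eq_zero_left e.symm]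
      exact hnz 0 (by simp)
    rw [h.sub_recursion h' k n hz1]
    refine (norm_add_le _ _).trans ?_
    refine (add_le_add (norm_sub_le _ _) hγ).trans ?_
    have h1 : ‖1 - z * (a n * b n z)‖ ≤ 2 := by
      refine (norm_sub_le _ _).trans ?_
      rw [norm_mul, norm_one]
      have := mul_le_one₀ hzn (norm_nonneg _) (h.norm_smul_le n n hz1)
      linarith
    have h2 : ‖z * (a' (n + 1 + k) * b' (n + 1) z)‖ ≤ 1 := by
      rw [norm_mul]
      exact mul_le_one₀ hzn (norm_nonneg _) (h'.norm_smul_le _ _ hz1)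
    rw [norm_mul, norm_mul (z * _)]
    have h3 := mul_le_mul (hn z hz) h1 (norm_nonneg _) (by positivity)
    have h4 := mul_le_mul h2 (hn0 z hz) (norm_nonneg _) zero_le_one
    linarith

theorem tendsto_of_locallySmall (h : IsSchurChain a b) (h' : IsSchurChain a' b')
    (hs : LocallySmall fun n z => a n * b n z - a' n * b' n z) (k : ℕ) :
    Tendsto (fun n => a (n + (k + 1)) * conj (a n) - a' (n + (k + 1)) * conj (a' n))
      atTop (𝓝 0) := by
  have h0 : (0 : ℂ) ∈ ball (0 : ℂ) 1 := by simp
  rw [Metric.tendsto_nhds]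
  intro ε hε
  filter_upwards [(tendsto_add_atTop_nat 1).eventually
    (h.locallySmall_smul_sub_of_locallySmall h' hs k 0 one_pos (ε / 2) (by positivity))] with n hn
  have e := h.sub_recursion h' k n h0
  simp only [zero_mul, sub_zero, mul_one] at e
  rw [dist_zero_right, ← norm_neg, ← eq_neg_of_add_eq_zero_left e.symm]
  have := hn 0 (by simp)
  linarith

/-- Each use of the recursion gains a factor 3/4, starting from the trivial bound 2. The bound must
hold for every k, since offset k at stage j + 1 uses offsets 0 and k + 1 at stage j. -/
theorem eventually_norm_smul_sub_le (h : IsSchurChain a b) (h' : IsSchurChain a' b')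
    (hγ : ∀ k : ℕ, Tendsto (fun n => a (n + (k + 1)) * conj (a n) - a' (n + (k + 1)) * conj (a' n))
      atTop (𝓝 0)) (j k : ℕ) :
    ∀ᶠ n in atTop, ∀ z : ℂ, ‖z‖ ≤ 1 / 4 →
      ‖a (n + k) * b n z - a' (n + k) * b' n z‖ ≤ 2 * (3 / 4) ^ j := by
  induction j generalizing k with
  | zero =>
    refine Eventually.of_forall fun n z hz => ?_
    have hz1 : z ∈ ball (0 : ℂ) 1 := by simpa using hz.trans_lt (by norm_num)
    refine (norm_sub_le _ _).trans ?_
    linarith [h.norm_smul_le (n + k) n hz1, h'.norm_smul_le (n + k) n hz1]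
  | succ j ih =>
    have hev : ∀ᶠ n in atTop, ∀ z : ℂ, ‖z‖ ≤ 1 / 4 →
        ‖a (n + 1 + k) * b (n + 1) z - a' (n + 1 + k) * b' (n + 1) z‖ ≤ 2 * (3 / 4) ^ (j + 1) := by
      -- With B the previous bound, ‖D‖ ≤ B/4 + ‖D‖/4 + B/4 + B/16, which is exactly ‖D‖ ≤ 3B/4.
      have hc : (0 : ℝ) < 2 * (3 / 4) ^ j / 16 := by positivity
      filter_upwards [ih 0, ih (k + 1), (Metric.tendsto_nhds.1 (hγ k)) _ hc] with n h0 h1 hn z hz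
      have hz1 : z ∈ ball (0 : ℂ) 1 := by simpa using hz.trans_lt (by norm_num)
      rw [dist_zero_right] at hn
      have e := h.sub_recursion h' k n hz1
      specialize h0 z hz
      specialize h1 z hz
      rw [add_zero] at h0
      set D := a (n + 1 + k) * b (n + 1) z - a' (n + 1 + k) * b' (n + 1) z
      set D0 := a n * b n z - a' n * b' n z
      set D1 := a (n + (k + 1)) * b n z - a' (n + (k + 1)) * b' n z
      set G := a (n + (k + 1)) * conj (a n) - a' (n + (k + 1)) * conj (a' n)
      have e2 : D = z * D1 + z * (a n * b n z) * D + z * (a' (n + 1 + k) * b' (n + 1) z) * D0 - G := by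
        linear_combination -e
      have key : ‖D‖ ≤ ‖z‖ * ‖D1‖ + ‖z‖ * 1 * ‖D‖ + ‖z‖ * 1 * ‖D0‖ + ‖G‖ := by
        calc ‖D‖ ≤ ‖z * D1‖ + ‖z * (a n * b n z) * D‖
              + ‖z * (a' (n + 1 + k) * b' (n + 1) z) * D0‖ + ‖G‖ := by
              conv_lhs => rw [e2]
              exact (norm_sub_le _ _).trans (by gcongr; exact norm_add₃_le)
          _ ≤ _ := by
              rw [norm_mul, norm_mul _ D, norm_mul _ D0, norm_mul z (a n * _), norm_mul z (a' _ * _)]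
              gcongr
              · exact h.norm_smul_le n n hz1
              · exact h'.norm_smul_le _ _ hz1
      have m1 := mul_le_mul hz h1 (norm_nonneg _) (by norm_num)
      have m2 := mul_le_mul_of_nonneg_right hz (norm_nonneg D)
      have m3 := mul_le_mul hz h0 (norm_nonneg _) (by norm_num)
      rw [pow_succ]
      linarith
    rw [← map_add_atTop_eq_nat 1]
    exact hev

theorem locallySmall_iff (h : IsSchurChain a b) (h' : IsSchurChain a' b') :
    (LocallySmall fun n z => a n * b n z - a' n * b' n z) ↔
      ∀ ℓ : ℕ, 1 ≤ ℓ → Tendsto (fun n => a (n + ℓ) * conj (a n) - a' (n + ℓ) * conj (a' n))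
        atTop (𝓝 0) := by
  constructor
  · intro hs ℓ hℓ
    obtain ⟨k, rfl⟩ := Nat.exists_eq_add_of_le' hℓ
    exact h.tendsto_of_locallySmall h' hs k
  · intro hγ
    refine LocallySmall.of_small_near_zero (M := 2) (ρ := 1 / 4) (by norm_num) (by norm_num)
      (h.differentiableOn_sub h' 0) (fun n z hz => ?_) (fun ε hε => ?_)
    · refine (norm_sub_le _ _).trans ?_
      linarith [h.norm_smul_le n n hz, h'.norm_smul_le n n hz]
    · obtain ⟨j, hj⟩ := exists_pow_lt_of_lt_one (half_pos hε) (show (3 / 4 : ℝ) < 1 by norm_num)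
      filter_upwards [h.eventually_norm_smul_sub_le h' (fun k => hγ (k + 1) (by omega)) j 0]
        with n hn z hz
      have := hn z hz
      rw [add_zero] at this
      linarith

end IsSchurChain

end OPUC

/-! ### Orthogonal polynomials: inner product, reversal, Szegő recursion, Schur property. -/

namespace OPUC

open Polynomial MeasureTheory ComplexConjugate Metric Filter Topology

section InnerProduct

variable (μ : Measure (sphere (0 : ℂ) 1))

theorem integrable_conj_eval_mul_eval [IsFiniteMeasure μ] (p q : ℂ[X]) :
    Integrable (fun z : sphere (0 : ℂ) 1 => conj (p.eval (z : ℂ)) * q.eval (z : ℂ)) μ := by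
  refine Continuous.integrable_of_hasCompactSupport ?_ (HasCompactSupport.of_compactSpace _)
  exact (Complex.continuous_conj.comp (p.continuous.comp continuous_subtype_val)).mul
    (q.continuous.comp continuous_subtype_val)

theorem polyInner_add_right [IsFiniteMeasure μ] (p q r : ℂ[X]) :
    polyInner μ p (q + r) = polyInner μ p q + polyInner μ p r := by
  simp only [polyInner, eval_add, mul_add]
  exact integral_add (integrable_conj_eval_mul_eval μ p q) (integrable_conj_eval_mul_eval μ p r)

theorem polyInner_C_mul_right (c : ℂ) (p q : ℂ[X]) :
    polyInner μ p (C c * q) = c * polyInner μ p q := by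
  simp only [polyInner, eval_mul, eval_C]
  rw [← integral_const_mul]
  congr 1
  ext z
  ring

theorem conj_polyInner (p q : ℂ[X]) : conj (polyInner μ p q) = polyInner μ q p := by
  simp only [polyInner]
  rw [← integral_conj]
  congr 1
  ext z
  simp [mul_comm]

theorem polyInner_zero_right (p : ℂ[X]) : polyInner μ p 0 = 0 := by simp [polyInner]

theorem polyInner_sub_right [IsFiniteMeasure μ] (p q r : ℂ[X]) :
    polyInner μ p (q - r) = polyInner μ p q - polyInner μ p r := by
  rw [eq_sub_iff_add_eq, ← polyInner_add_right, sub_add_cancel]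

theorem polyInner_sum_right [IsFiniteMeasure μ] {ι : Type*} (s : Finset ι) (p : ℂ[X])
    (q : ι → ℂ[X]) : polyInner μ p (∑ i ∈ s, q i) = ∑ i ∈ s, polyInner μ p (q i) := by
  classical
  induction s using Finset.induction_on with
  | empty => simp [polyInner_zero_right]
  | insert i s hi ih => rw [Finset.sum_insert hi, Finset.sum_insert hi, polyInner_add_right, ih]

theorem polyInner_eq_zero_symm {p q : ℂ[X]} (h : polyInner μ p q = 0) : polyInner μ q p = 0 := by
  rw [← conj_polyInner, h, map_zero]

theorem polyInner_sub_left [IsFiniteMeasure μ] (p q r : ℂ[X]) :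
    polyInner μ (p - q) r = polyInner μ p r - polyInner μ q r := by
  rw [← conj_polyInner, polyInner_sub_right, map_sub, conj_polyInner, conj_polyInner]

theorem polyInner_C_mul_left (c : ℂ) (p q : ℂ[X]) :
    polyInner μ (C c * p) q = conj c * polyInner μ p q := by
  rw [← conj_polyInner, polyInner_C_mul_right, map_mul, conj_polyInner]

theorem polyInner_X_mul_X_mul (p q : ℂ[X]) : polyInner μ (X * p) (X * q) = polyInner μ p q := by
  simp only [polyInner]
  congr 1
  ext z
  have hz : conj (z : ℂ) * z = 1 := by
    rw [← Complex.normSq_eq_conj_mul_self, Complex.normSq_eq_norm_sq, mem_sphere_zero_iff_norm.1 z.2]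
    simp
  simp only [eval_mul, eval_X, map_mul]
  linear_combination (conj (p.eval (z : ℂ)) * q.eval (z : ℂ)) * hz

theorem polyInner_self (p : ℂ[X]) :
    polyInner μ p p = ((∫ z : sphere (0 : ℂ) 1, ‖p.eval (z : ℂ)‖ ^ 2 ∂μ : ℝ) : ℂ) := by
  rw [polyInner, ← integral_complex_ofReal]
  congr 1
  ext z
  rw [← Complex.normSq_eq_conj_mul_self, Complex.normSq_eq_norm_sq]

variable {μ}

/-- Otherwise p vanishes μ-almost everywhere, so its finite closed zero set contains the support. -/
theorem eq_zero_of_polyInner_self [IsFiniteMeasure μ] (hμ : Nontrivial μ) {p : ℂ[X]}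
    (h : polyInner μ p p = 0) : p = 0 := by
  by_contra hp
  rw [polyInner_self, Complex.ofReal_eq_zero, integral_eq_zero_iff_of_nonneg
    (fun z => by positivity)] at h
  · refine hμ (Set.Finite.subset ?_ (Measure.support_subset_of_isClosed
      (t := {z : sphere (0 : ℂ) 1 | p.eval (z : ℂ) = 0}) ?_ ?_))
    · have : ((fun z : sphere (0 : ℂ) 1 => (z : ℂ)) ⁻¹' {z | p.IsRoot z}).Finite :=
        (Polynomial.finite_setOfPred_isRoot hp).preimage Subtype.val_injective.injOn
      exact this
    · exact isClosed_eq (p.continuous.comp continuous_subtype_val) continuous_const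
    · filter_upwards [h] with z hz
      simpa using hz
  · refine Continuous.integrable_of_hasCompactSupport ?_ (HasCompactSupport.of_compactSpace _)
    exact (p.continuous.comp continuous_subtype_val).norm.pow 2

end InnerProduct

/-- The reversal `p ↦ z ^ n * conj (p (1 / conj z))` on polynomials of degree at most `n`. -/
noncomputable def conjReflect (n : ℕ) (p : ℂ[X]) : ℂ[X] := (p.map (starRingEnd ℂ)).reflect n

theorem coeff_conjReflect (n : ℕ) (p : ℂ[X]) {i : ℕ} (hi : i ≤ n) :
    (conjReflect n p).coeff i = conj (p.coeff (n - i)) := by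
  rw [conjReflect, coeff_reflect, revAt_le hi, coeff_map]

theorem coeff_conjReflect_of_lt (n : ℕ) {p : ℂ[X]} (hp : p.natDegree ≤ n) {i : ℕ} (hi : n < i) :
    (conjReflect n p).coeff i = 0 := by
  rw [conjReflect, coeff_reflect, revAt_eq_self_of_lt hi, coeff_map,
    coeff_eq_zero_of_natDegree_lt (hp.trans_lt hi), map_zero]

theorem natDegree_conjReflect_le {n : ℕ} {p : ℂ[X]} (hp : p.natDegree ≤ n) :
    (conjReflect n p).natDegree ≤ n :=
  natDegree_le_iff_coeff_eq_zero.2 fun _ hi => coeff_conjReflect_of_lt n hp hi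

theorem degree_conjReflect_lt {n : ℕ} {p : ℂ[X]} (hp : p.natDegree ≤ n) (h0 : p.coeff 0 = 0) :
    (conjReflect n p).degree < n := by
  rw [degree_lt_iff_coeff_zero]
  intro i hi
  rcases hi.eq_or_lt with rfl | hi
  · rw [coeff_conjReflect _ _ le_rfl, Nat.sub_self, h0, map_zero]
  · exact coeff_conjReflect_of_lt n hp hi

theorem conjReflect_conjReflect (n : ℕ) (p : ℂ[X]) : conjReflect n (conjReflect n p) = p := by
  ext i
  simp [conjReflect, coeff_reflect]

theorem conjReflect_sub (n : ℕ) (p q : ℂ[X]) :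
    conjReflect n (p - q) = conjReflect n p - conjReflect n q := by
  ext i
  simp [conjReflect, coeff_reflect]

theorem conjReflect_C_mul (n : ℕ) (c : ℂ) (p : ℂ[X]) :
    conjReflect n (C c * p) = C (conj c) * conjReflect n p := by
  ext i
  simp [conjReflect, coeff_reflect]

theorem conjReflect_succ {n : ℕ} {p : ℂ[X]} (hp : p.natDegree ≤ n) :
    conjReflect (n + 1) p = X * conjReflect n p := by
  have := reflect_mul (1 : ℂ[X]) (p.map (starRingEnd ℂ)) (F := 1) (G := n) (by simp)
    (natDegree_map_le.trans hp)
  rwa [one_mul, add_comm, reflect_one, pow_one] at this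

theorem conjReflect_succ_X_mul {n : ℕ} {p : ℂ[X]} (hp : p.natDegree ≤ n) :
    conjReflect (n + 1) (X * p) = conjReflect n p := by
  have hX : conjReflect 1 X = 1 := by
    have h1 := conjReflect_succ (n := 0) (p := 1) (by simp)
    have h2 : conjReflect 0 1 = 1 := by simp [conjReflect]
    rw [h2, mul_one, zero_add] at h1
    rw [← h1, conjReflect_conjReflect]
  have := reflect_mul (X : ℂ[X]) (p.map (starRingEnd ℂ)) (F := 1) (G := n) (by simp)
    (natDegree_map_le.trans hp)
  rw [add_comm] at this
  rw [conjReflect, Polynomial.map_mul, map_X, this]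
  rw [conjReflect, map_X] at hX
  rw [hX, one_mul, conjReflect]

theorem eval_conjReflect {n : ℕ} {p : ℂ[X]} (hp : p.natDegree ≤ n) {z : ℂ} (hz : ‖z‖ = 1) :
    (conjReflect n p).eval z = z ^ n * conj (p.eval z) := by
  have hz0 : z ≠ 0 := by
    rintro rfl
    simp at hz
  have hconj : conj z = z⁻¹ := by rw [Complex.inv_def, Complex.normSq_eq_norm_sq, hz]; simp
  let _ : Invertible z⁻¹ := invertibleOfNonzero (inv_ne_zero hz0)
  have := eval₂_reflect_mul_pow (RingHom.id ℂ) z⁻¹ n (p.map (starRingEnd ℂ))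
    (natDegree_map_le.trans hp)
  rw [invOf_eq_inv, inv_inv, ← eval, ← eval, ← hconj, eval_map_apply] at this
  rw [conjReflect, ← this, hconj, inv_pow]
  field_simp

/-- On the circle both integrands equal z^n conj(p) conj(q). -/
theorem polyInner_conjReflect (μ : Measure (sphere (0 : ℂ) 1)) {n : ℕ} {p q : ℂ[X]}
    (hp : p.natDegree ≤ n) (hq : q.natDegree ≤ n) :
    polyInner μ p (conjReflect n q) = polyInner μ q (conjReflect n p) := by
  simp only [polyInner]
  congr 1
  ext z
  have hz := mem_sphere_zero_iff_norm.1 z.2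
  rw [eval_conjReflect hp hz, eval_conjReflect hq hz]
  ring

section OrthogonalPolynomials

variable (μ : Measure (sphere (0 : ℂ) 1))

theorem monicOP_eq (n : ℕ) : monicOP μ n = X ^ n - ∑ k : Fin n,
    C (polyInner μ (monicOP μ k) (X ^ n) / polyInner μ (monicOP μ k) (monicOP μ k)) *
      monicOP μ k := by
  rw [monicOP]

theorem degree_sum_lt (n : ℕ) (c : Fin n → ℂ) (q : Fin n → ℂ[X])
    (hq : ∀ k, (q k).degree ≤ (k : ℕ)) : (∑ k : Fin n, C (c k) * q k).degree < n := by
  refine (degree_sum_le _ _).trans_lt ((Finset.sup_lt_iff (WithBot.bot_lt_coe n)).2 fun k _ => ?_)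
  refine lt_of_le_of_lt ?_ (Nat.cast_lt.2 k.2)
  calc (C (c k) * q k).degree ≤ (C (c k)).degree + (q k).degree := degree_mul_le _ _
    _ ≤ 0 + (k : ℕ) := add_le_add degree_C_le (hq k)
    _ = _ := zero_add _

theorem degree_monicOP (n : ℕ) : (monicOP μ n).degree = n := by
  induction n using Nat.strong_induction_on with
  | _ n ih =>
    rw [monicOP_eq, degree_sub_eq_left_of_degree_lt, degree_X_pow]
    rw [degree_X_pow]
    exact degree_sum_lt n _ _ fun k => (ih k k.2).le

theorem natDegree_monicOP (n : ℕ) : (monicOP μ n).natDegree = n :=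
  natDegree_eq_of_degree_eq_some (degree_monicOP μ n)

theorem monic_monicOP (n : ℕ) : (monicOP μ n).Monic := by
  rw [monicOP_eq]
  refine (monic_X_pow n).sub_of_left ?_
  rw [degree_X_pow]
  exact degree_sum_lt n _ _ fun k => (degree_monicOP μ k).le

theorem coeff_monicOP_self (n : ℕ) : (monicOP μ n).coeff n = 1 := by
  have := (monic_monicOP μ n).coeff_natDegree
  rwa [natDegree_monicOP] at this

theorem reversedOP_eq (n : ℕ) : reversedOP μ n = conjReflect n (monicOP μ n) := rfl

theorem natDegree_reversedOP_le (n : ℕ) : (reversedOP μ n).natDegree ≤ n :=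
  natDegree_conjReflect_le (natDegree_monicOP μ n).le

theorem coeff_zero_reversedOP (n : ℕ) : (reversedOP μ n).coeff 0 = 1 := by
  rw [reversedOP_eq, coeff_conjReflect _ _ (Nat.zero_le n), Nat.sub_zero, coeff_monicOP_self,
    map_one]

variable {μ}

theorem polyInner_monicOP_self_ne_zero [IsFiniteMeasure μ] (hμ : Nontrivial μ) (n : ℕ) :
    polyInner μ (monicOP μ n) (monicOP μ n) ≠ 0 := fun h =>
  (monic_monicOP μ n).ne_zero (eq_zero_of_polyInner_self hμ h)

theorem polyInner_monicOP_of_lt [IsFiniteMeasure μ] (hμ : Nontrivial μ) {n j : ℕ} (hj : j < n) :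
    polyInner μ (monicOP μ j) (monicOP μ n) = 0 := by
  induction n using Nat.strong_induction_on generalizing j with
  | _ n ih =>
    conv_lhs => rw [monicOP_eq μ n]
    rw [polyInner_sub_right, polyInner_sum_right, Finset.sum_eq_single (⟨j, hj⟩ : Fin n)]
    · rw [polyInner_C_mul_right, div_mul_cancel₀ _ (polyInner_monicOP_self_ne_zero hμ j), sub_self]
    · intro k _ hk
      rw [polyInner_C_mul_right]
      have hkj : (k : ℕ) ≠ j := fun h => hk (Fin.ext h)
      rcases hkj.lt_or_gt with h | h
      · rw [polyInner_eq_zero_symm μ (ih j hj h), mul_zero]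
      · rw [ih k k.2 h, mul_zero]
    · simp

theorem polyInner_monicOP_of_degree_lt [IsFiniteMeasure μ] (hμ : Nontrivial μ) {n : ℕ} {p : ℂ[X]}
    (hp : p.degree < n) : polyInner μ p (monicOP μ n) = 0 := by
  suffices H : ∀ m ≤ n, ∀ p : ℂ[X], p.degree < m → polyInner μ (monicOP μ n) p = 0 from
    polyInner_eq_zero_symm μ (H n le_rfl p hp)
  intro m
  induction m with
  | zero =>
    intro _ p hp
    rw [degree_lt_iff_coeff_zero] at hp
    have : p = 0 := by ext i; simpa using hp i (Nat.zero_le i)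
    rw [this, polyInner_zero_right]
  | succ m ih =>
    intro hm p hp
    have hq := ih (by omega) (p - C (p.coeff m) * monicOP μ m) (by
      rw [degree_lt_iff_coeff_zero] at hp ⊢
      intro i hi
      rcases hi.eq_or_lt with rfl | hi
      · rw [coeff_sub, coeff_C_mul, coeff_monicOP_self, mul_one, sub_self]
      · rw [coeff_sub, coeff_C_mul, hp i hi, coeff_eq_zero_of_natDegree_lt
          ((natDegree_monicOP μ m).trans_lt hi), mul_zero, sub_zero])
    rwa [polyInner_sub_right, polyInner_C_mul_right, polyInner_eq_zero_symm μ
      (polyInner_monicOP_of_lt hμ (by omega : m < n)), mul_zero, sub_zero] at hq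

theorem conj_verblunsky (μ : Measure (sphere (0 : ℂ) 1)) (n : ℕ) :
    conj (verblunsky μ n) = -(monicOP μ (n + 1)).coeff 0 := by
  rw [verblunsky, map_neg, Complex.conj_conj, coeff_zero_eq_eval_zero]

/-- The Szegő recursion. -/
theorem monicOP_succ [IsFiniteMeasure μ] (hμ : Nontrivial μ) (n : ℕ) :
    monicOP μ (n + 1) = X * monicOP μ n - C (conj (verblunsky μ n)) * reversedOP μ n := by
  -- R has degree at most n and R(0) = 0, which makes it orthogonal to each of the three terms
  -- composing it, hence to itself.
  set R := monicOP μ (n + 1) - (X * monicOP μ n - C (conj (verblunsky μ n)) * reversedOP μ n) with hR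
  have hR0 : R.coeff 0 = 0 := by
    rw [hR, coeff_sub, coeff_sub, coeff_C_mul, coeff_zero_reversedOP, conj_verblunsky]
    simp
  have hRdeg : R.degree < (n + 1 : ℕ) := by
    rw [degree_lt_iff_coeff_zero]
    intro i hi
    obtain ⟨i, rfl⟩ := Nat.exists_eq_add_of_le' (le_trans (Nat.le_add_left 1 n) hi)
    have h1 : (reversedOP μ n).coeff (i + 1) = 0 :=
      coeff_eq_zero_of_natDegree_lt ((natDegree_reversedOP_le μ n).trans_lt (by omega))
    rw [hR, coeff_sub, coeff_sub, coeff_C_mul, coeff_X_mul, h1, mul_zero, sub_zero]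
    rcases hi.eq_or_lt with h | h
    · obtain rfl : n = i := by omega
      rw [coeff_monicOP_self, coeff_monicOP_self, sub_self]
    · rw [coeff_eq_zero_of_natDegree_lt ((natDegree_monicOP μ (n + 1)).trans_lt h),
        coeff_eq_zero_of_natDegree_lt ((natDegree_monicOP μ n).trans_lt (by omega)), sub_self]
  have hRnat : R.natDegree ≤ n := by
    rw [natDegree_le_iff_coeff_eq_zero]
    exact fun i hi => (degree_lt_iff_coeff_zero _ _).1 hRdeg i hi
  obtain ⟨R₁, hR₁⟩ := X_dvd_iff.2 hR0
  have hR₁deg : R₁.degree < n := by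
    rw [degree_lt_iff_coeff_zero] at hRdeg ⊢
    intro i hi
    have := hRdeg (i + 1) (by omega)
    rwa [hR₁, coeff_X_mul] at this
  have h1 : polyInner μ R (monicOP μ (n + 1)) = 0 := polyInner_monicOP_of_degree_lt hμ hRdeg
  have h2 : polyInner μ R (X * monicOP μ n) = 0 := by
    rw [hR₁, polyInner_X_mul_X_mul]
    exact polyInner_monicOP_of_degree_lt hμ hR₁deg
  have h3 : polyInner μ R (reversedOP μ n) = 0 := by
    rw [reversedOP_eq, polyInner_conjReflect μ hRnat (natDegree_monicOP μ n).le]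
    exact polyInner_eq_zero_symm μ
      (polyInner_monicOP_of_degree_lt hμ (degree_conjReflect_lt hRnat hR0))
  have hRR : polyInner μ R R = 0 := by
    conv_lhs => arg 3; rw [hR]
    rw [polyInner_sub_right, polyInner_sub_right, polyInner_C_mul_right, h1, h2, h3]
    simp
  exact sub_eq_zero.1 (eq_zero_of_polyInner_self hμ hRR)

theorem reversedOP_succ [IsFiniteMeasure μ] (hμ : Nontrivial μ) (n : ℕ) :
    reversedOP μ (n + 1) = reversedOP μ n - C (verblunsky μ n) * (X * monicOP μ n) := by
  rw [reversedOP_eq, monicOP_succ hμ, conjReflect_sub, conjReflect_C_mul, Complex.conj_conj,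
    conjReflect_succ_X_mul (natDegree_monicOP μ n).le,
    conjReflect_succ (natDegree_reversedOP_le μ n), reversedOP_eq, conjReflect_conjReflect]

/-- Orthogonality of Φ_{n+1} to Φ_n^* and ‖Φ_n^*‖ = ‖Φ_n‖ give ‖Φ_{n+1}‖² = (1 - |α_n|²)‖Φ_n‖². -/
theorem norm_verblunsky_le_one [IsFiniteMeasure μ] (hμ : Nontrivial μ) (n : ℕ) :
    ‖verblunsky μ n‖ ≤ 1 := by
  have hrev : polyInner μ (reversedOP μ n) (reversedOP μ n) =
      polyInner μ (monicOP μ n) (monicOP μ n) := by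
    conv_lhs => arg 3; rw [reversedOP_eq]
    rw [polyInner_conjReflect μ (natDegree_reversedOP_le μ n) (natDegree_monicOP μ n).le,
      reversedOP_eq, conjReflect_conjReflect]
  have horth : polyInner μ (reversedOP μ n) (monicOP μ (n + 1)) = 0 :=
    polyInner_monicOP_of_degree_lt hμ (degree_le_natDegree.trans_lt
      (Nat.cast_lt.2 (Nat.lt_succ_of_le (natDegree_reversedOP_le μ n))))
  have h1 := horth
  rw [monicOP_succ hμ, polyInner_sub_right, polyInner_C_mul_right, hrev, sub_eq_zero] at h1
  have h2 : polyInner μ (monicOP μ (n + 1)) (monicOP μ (n + 1)) =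
      polyInner μ (monicOP μ (n + 1)) (X * monicOP μ n) := by
    conv_lhs => arg 3; rw [monicOP_succ hμ]
    rw [polyInner_sub_right, polyInner_C_mul_right, polyInner_eq_zero_symm μ horth, mul_zero,
      sub_zero]
  have h3 : polyInner μ (monicOP μ (n + 1)) (X * monicOP μ n) =
      (1 - verblunsky μ n * conj (verblunsky μ n)) * polyInner μ (monicOP μ n) (monicOP μ n) := by
    rw [monicOP_succ hμ, polyInner_sub_left, polyInner_C_mul_left, Complex.conj_conj, h1,
      polyInner_X_mul_X_mul]
    ring
  have hne := polyInner_monicOP_self_ne_zero hμ n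
  rw [← h2, Complex.mul_conj, Complex.normSq_eq_norm_sq] at h3
  rw [polyInner_self] at hne
  rw [polyInner_self, polyInner_self] at h3
  norm_cast at h3 hne
  have hA : 0 ≤ ∫ z : sphere (0 : ℂ) 1, ‖(monicOP μ (n + 1)).eval (z : ℂ)‖ ^ 2 ∂μ :=
    integral_nonneg fun z => by positivity
  have hB : 0 < ∫ z : sphere (0 : ℂ) 1, ‖(monicOP μ n).eval (z : ℂ)‖ ^ 2 ∂μ :=
    lt_of_le_of_ne (integral_nonneg fun z => by positivity) (Ne.symm hne)
  rw [h3] at hA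
  have := nonneg_of_mul_nonneg_left hA hB
  exact (sq_le_one_iff₀ (norm_nonneg _)).1 (by linarith)

end OrthogonalPolynomials

/-- The Möbius self-map of the disk in undivided form, valid also for |a| = 1; it propagates the
Schur bound. -/
theorem norm_sub_conj_le {a w : ℂ} (ha : ‖a‖ ≤ 1) (hw : ‖w‖ ≤ 1) :
    ‖w - conj a‖ ≤ ‖1 - a * w‖ := by
  refine (sq_le_sq₀ (norm_nonneg _) (norm_nonneg _)).1 ?_
  have key : ‖1 - a * w‖ ^ 2 - ‖w - conj a‖ ^ 2 = (1 - ‖a‖ ^ 2) * (1 - ‖w‖ ^ 2) := by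
    simp only [← Complex.normSq_eq_norm_sq, Complex.normSq_apply, Complex.sub_re, Complex.sub_im,
      Complex.mul_re, Complex.mul_im, Complex.one_re, Complex.one_im, Complex.conj_re,
      Complex.conj_im]
    ring
  have h1 : ‖a‖ ^ 2 ≤ 1 := pow_le_one₀ (norm_nonneg _) ha
  have h2 : ‖w‖ ^ 2 ≤ 1 := pow_le_one₀ (norm_nonneg _) hw
  nlinarith [mul_nonneg (sub_nonneg.2 h1) (sub_nonneg.2 h2)]

theorem one_sub_mul_ne_zero {a z b : ℂ} (ha : ‖a‖ ≤ 1) (hz : ‖z‖ < 1) (hb : ‖b‖ ≤ 1) :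
    1 - a * z * b ≠ 0 := by
  intro h
  have h1 : ‖a * z * b‖ = 1 := by rw [← sub_eq_zero.1 h, norm_one]
  rw [norm_mul, norm_mul] at h1
  have h2 : ‖a‖ * ‖z‖ ≤ ‖z‖ := mul_le_of_le_one_left (norm_nonneg _) ha
  have h3 : ‖a‖ * ‖z‖ * ‖b‖ ≤ ‖a‖ * ‖z‖ := mul_le_of_le_one_right (by positivity) hb
  linarith

section SchurChain

variable {μ : Measure (sphere (0 : ℂ) 1)} [IsFiniteMeasure μ]

theorem eval_reversedOP_succ (hμ : Nontrivial μ) (n : ℕ) {z : ℂ}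
    (h : (reversedOP μ n).eval z ≠ 0) :
    (reversedOP μ (n + 1)).eval z = (reversedOP μ n).eval z *
      (1 - verblunsky μ n * z * ((monicOP μ n).eval z / (reversedOP μ n).eval z)) := by
  rw [reversedOP_succ hμ, eval_sub, eval_mul, eval_mul, eval_C, eval_X]
  field_simp

theorem div_reversedOP_recursion (hμ : Nontrivial μ) (n : ℕ) {z : ℂ}
    (h : (reversedOP μ n).eval z ≠ 0) (h' : (reversedOP μ (n + 1)).eval z ≠ 0) :
    (monicOP μ (n + 1)).eval z / (reversedOP μ (n + 1)).eval z *
      (1 - verblunsky μ n * z * ((monicOP μ n).eval z / (reversedOP μ n).eval z)) =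
      z * ((monicOP μ n).eval z / (reversedOP μ n).eval z) - conj (verblunsky μ n) := by
  rw [eval_reversedOP_succ hμ n h] at h' ⊢
  rw [div_mul_eq_mul_div, mul_div_mul_right _ _ (right_ne_zero_of_mul h'), monicOP_succ hμ, eval_sub,
    eval_mul, eval_mul, eval_C, eval_X]
  field_simp

/-- The two claims need a joint induction: the bound on b_n keeps 1 - α_n z b_n away from zero,
hence Φ*_{n+1}(z) ≠ 0, and then the recursion bounds b_{n+1}. -/
theorem reversedOP_ne_zero_and_norm_div_le (hμ : Nontrivial μ) (n : ℕ) {z : ℂ} (hz : ‖z‖ < 1) :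
    (reversedOP μ n).eval z ≠ 0 ∧ ‖(monicOP μ n).eval z / (reversedOP μ n).eval z‖ ≤ 1 := by
  induction n with
  | zero =>
    have h : monicOP μ 0 = 1 := by rw [monicOP_eq]; simp
    have h' : reversedOP μ 0 = 1 := by rw [reversedOP_eq, h, conjReflect]; simp
    simp [h, h']
  | succ n ih =>
    obtain ⟨h0, hb⟩ := ih
    have ha := norm_verblunsky_le_one hμ n
    have h1 := one_sub_mul_ne_zero ha hz hb
    have h0' : (reversedOP μ (n + 1)).eval z ≠ 0 := by
      rw [eval_reversedOP_succ hμ n h0]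
      exact mul_ne_zero h0 h1
    refine ⟨h0', ?_⟩
    have e := congrArg norm (div_reversedOP_recursion hμ n h0 h0')
    rw [norm_mul] at e
    have hw : ‖z * ((monicOP μ n).eval z / (reversedOP μ n).eval z)‖ ≤ 1 := by
      rw [norm_mul]
      exact mul_le_one₀ hz.le (norm_nonneg _) hb
    have := norm_sub_conj_le ha hw
    rw [← mul_assoc, ← e] at this
    exact (mul_le_iff_le_one_left (norm_pos_iff.2 h1)).1 this

theorem isSchurChain (hμ : Nontrivial μ) :
    IsSchurChain (verblunsky μ) fun n z => (monicOP μ n).eval z / (reversedOP μ n).eval z where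
  norm_param_le := norm_verblunsky_le_one hμ
  differentiableOn n := (monicOP μ n).differentiable.differentiableOn.div
    (reversedOP μ n).differentiable.differentiableOn fun z hz =>
      (reversedOP_ne_zero_and_norm_div_le hμ n (by simpa using hz)).1
  norm_le n z hz := (reversedOP_ne_zero_and_norm_div_le hμ n (by simpa using hz)).2
  recursion n z hz := div_reversedOP_recursion hμ n
    (reversedOP_ne_zero_and_norm_div_le hμ n (by simpa using hz)).1
    (reversedOP_ne_zero_and_norm_div_le hμ (n + 1) (by simpa using hz)).1

theorem reversedOP_ratio (hμ : Nontrivial μ) (n : ℕ) {z : ℂ} (hz : ‖z‖ < 1) :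
    (reversedOP μ (n + 1)).eval z / (reversedOP μ n).eval z =
      1 - z * (verblunsky μ n * ((monicOP μ n).eval z / (reversedOP μ n).eval z)) := by
  have h := (reversedOP_ne_zero_and_norm_div_le hμ n hz).1
  rw [eval_reversedOP_succ hμ n h, mul_div_cancel_left₀ _ h]
  ring

end SchurChain

theorem LocallySmall.congr_norm {F G : ℕ → ℂ → ℂ} (h : ∀ n z, ‖z‖ < 1 → ‖F n z‖ = ‖G n z‖)
    (hF : LocallySmall F) : LocallySmall G := by
  intro r hr ε hε
  filter_upwards [hF r hr ε hε] with n hn z hz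
  rw [← h n z (hz.trans_lt hr)]
  exact hn z hz

end OPUC

/-- The index is shifted by ℓ, so no truncated subtraction n - ℓ occurs. -/
theorem theorem4p1 (μ ν : MeasureTheory.Measure (Metric.sphere (0 : ℂ) 1))
    [MeasureTheory.IsProbabilityMeasure μ] [MeasureTheory.IsProbabilityMeasure ν]
    (hμ : OPUC.Nontrivial μ) (hν : OPUC.Nontrivial ν) :
    (∀ K : Set ℂ, IsCompact K → K ⊆ Metric.ball (0 : ℂ) 1 →
      TendstoUniformlyOn
        (fun (n : ℕ) (z : ℂ) =>
          (OPUC.reversedOP μ (n + 1)).eval z / (OPUC.reversedOP μ n).eval z -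
            (OPUC.reversedOP ν (n + 1)).eval z / (OPUC.reversedOP ν n).eval z)
        (fun _ => (0 : ℂ)) Filter.atTop K) ↔
    (∀ ℓ : ℕ, 1 ≤ ℓ →
      Filter.Tendsto
        (fun n : ℕ =>
          OPUC.verblunsky μ (n + ℓ) * (starRingEnd ℂ) (OPUC.verblunsky μ n) -
            OPUC.verblunsky ν (n + ℓ) * (starRingEnd ℂ) (OPUC.verblunsky ν n))
        Filter.atTop (nhds (0 : ℂ))) := by
  have h := OPUC.isSchurChain hμ
  have h' := OPUC.isSchurChain hν
  rw [OPUC.tendstoUniformlyOn_compacts_iff_locallySmall, ← h.locallySmall_iff h']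
  -- The ratio difference is -z times the Schur difference; comparing norms absorbs the sign.
  refine Iff.trans ?_ (OPUC.locallySmall_id_mul_iff fun n => h.differentiableOn_sub h' 0 n)
  have e : ∀ (n : ℕ) (z : ℂ), ‖z‖ < 1 →
      ‖(OPUC.reversedOP μ (n + 1)).eval z / (OPUC.reversedOP μ n).eval z -
        (OPUC.reversedOP ν (n + 1)).eval z / (OPUC.reversedOP ν n).eval z‖ =
      ‖z * (OPUC.verblunsky μ n * ((OPUC.monicOP μ n).eval z / (OPUC.reversedOP μ n).eval z) -
        OPUC.verblunsky ν n * ((OPUC.monicOP ν n).eval z / (OPUC.reversedOP ν n).eval z))‖ := by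
    intro n z hz
    rw [OPUC.reversedOP_ratio hμ n hz, OPUC.reversedOP_ratio hν n hz, ← norm_neg]
    congr 1
    ring
  exact ⟨fun H => H.congr_norm e, fun H => H.congr_norm fun n z hz => (e n z hz).symm⟩
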